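/- Let $n\ge 0$ and let $\mathbb P^n$ be the complex projective space of dimension $n$, with standard projection $\Pi:\mathbb C^{n+1}\setminus\{0\}\to\mathbb P^n$. For a holomorphic curve $f:\mathbb C\to\mathbb P^n$ its spherical derivative is $$f^\#=\frac{\bigl(\sum_{i<j}|f_i'f_j-f_if_j'|^2\bigr)^{1/2}}{|f_0|^2+\dots+|f_n|^2},$$ where $f=\Pi\circ(f_0,\dots,f_n)$ (near the point in question) with holomorphic functions $f_0,\dots,f_n$ without common zeros; $f^\#$ does not depend on the choice of $(f_0,\dots,f_n)$. A holomorphic curve $f:\mathbb C\to\mathbb P^n$ is called normal if $\sup_{\mathbb C}f^\#<\infty$. For $K>0$, a set $E\subset\mathbb C$ is called $K$-sparse if any two distinct points of $E$ are at distance at least $K$. **Theorem.** For every $n$ there is a constant $C(n)>0$, depending only on $n$, with the following property. For every $K>0$, every $K$-sparse set $E\subset\mathbb C$ and every map $b:E\to\mathbb P^n$ there is a normal holomorphic curve $f:\mathbb C\to\mathbb P^n$ with $\sup_{z\in\mathbb C}f^\#(z)\le C(n)/K$ and $f(m)=b(m)$ for all $m\in E$. -/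

import Mathlib

open Filter Topology

namespace NormalCurves

/-- Complex projective space of dimension `n`, the set of lines in `ℂ^(n+1)`, where `ℂ^(n+1)`
carries its standard Hermitian norm. -/
abbrev PSpace (n : ℕ) : Type :=
  Projectivization ℂ (EuclideanSpace ℂ (Fin (n + 1)))

/-- `F` is a reduced homogeneous representation of `f` near the point `z`: in a neighbourhood of
`z` it is holomorphic, has no zeros (its coordinates have no common zeros), and `f = Π ∘ F`. -/
def IsReducedRepAt {n : ℕ} (f : ℂ → PSpace n) (F : ℂ → EuclideanSpace ℂ (Fin (n + 1)))
    (z : ℂ) : Prop :=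
  ∀ᶠ w in 𝓝 z, DifferentiableAt ℂ F w ∧ ∃ h : F w ≠ 0, f w = Projectivization.mk ℂ (F w) h

/-- `f : ℂ → ℙⁿ` is a holomorphic curve. Since `Π : ℂ^(n+1) ∖ {0} → ℙⁿ` is holomorphic and has
holomorphic local sections (the affine charts), a map into `ℙⁿ` is holomorphic if and only if it
lifts holomorphically through `Π` near every point. -/
def IsHolomorphicCurve {n : ℕ} (f : ℂ → PSpace n) : Prop :=
  ∀ z, ∃ F, IsReducedRepAt f F z

/-- The expression `(∑_{i<j} |F_i' F_j - F_i F_j'|²)^(1/2) / ‖F‖²` at the point `z`. -/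
noncomputable def repSphericalDeriv {n : ℕ} (F : ℂ → EuclideanSpace ℂ (Fin (n + 1)))
    (z : ℂ) : ℝ :=
  √(∑ i, ∑ j ∈ Finset.Ioi i,
    ‖deriv (fun w => F w i) z * F z j - F z i * deriv (fun w => F w j) z‖ ^ 2) / ‖F z‖ ^ 2

open Classical in
/-- The spherical derivative `f^#` of a curve, computed from any reduced homogeneous
representation near the point; `sphericalDeriv_eq` shows that the choice does not matter. -/
noncomputable def sphericalDeriv {n : ℕ} (f : ℂ → PSpace n) (z : ℂ) : ℝ :=
  if h : ∃ F, IsReducedRepAt f F z then repSphericalDeriv h.choose z else 0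

theorem repSphericalDeriv_congr {n : ℕ} {f : ℂ → PSpace n}
    {F G : ℂ → EuclideanSpace ℂ (Fin (n + 1))} {z : ℂ}
    (hF : IsReducedRepAt f F z) (hG : IsReducedRepAt f G z) :
    repSphericalDeriv F z = repSphericalDeriv G z := by
  have hFz := hF.self_of_nhds
  have hGz := hG.self_of_nhds
  obtain ⟨dF, hF0, -⟩ := hFz
  obtain ⟨dG, hG0, -⟩ := hGz
  have dFi : ∀ i, DifferentiableAt ℂ (fun w => F w i) z := fun i =>
    (differentiableAt_euclidean.1 dF) i
  have dGi : ∀ i, DifferentiableAt ℂ (fun w => G w i) z := fun i =>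
    (differentiableAt_euclidean.1 dG) i
  obtain ⟨k, hk⟩ : ∃ k, G z k ≠ 0 := by
    by_contra! hcon
    exact hG0 (by ext i; simpa using hcon i)
  have hkn : ∀ᶠ w in 𝓝 z, G w k ≠ 0 := (dGi k).continuousAt.eventually_ne hk
  set u : ℂ → ℂ := fun w => F w k / G w k with hu
  have du : DifferentiableAt ℂ u z := (dFi k).div (dGi k) hk
  have key : ∀ᶠ w in 𝓝 z, ∀ i, F w i = u w * G w i := by
    filter_upwards [hF, hG, hkn] with w h1 h2 h3
    obtain ⟨-, h1n, h1⟩ := h1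
    obtain ⟨-, h2n, h2⟩ := h2
    obtain ⟨a, ha⟩ := (Projectivization.mk_eq_mk_iff' ℂ _ _ h1n h2n).1 (h1.symm.trans h2)
    intro i
    have hi : ∀ i, F w i = a * G w i := fun i => by rw [← ha]; simp
    rw [hu]
    simp only [hi]
    field_simp
  have hval : ∀ i, F z i = u z * G z i := key.self_of_nhds
  have hder : ∀ i, deriv (fun w => F w i) z
      = deriv u z * G z i + u z * deriv (fun w => G w i) z := fun i => by
    rw [Filter.EventuallyEq.deriv_eq (key.mono fun w hw => hw i)]
    exact deriv_fun_mul du (dGi i)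
  have hvec : F z = u z • G z := by ext i; simp [hval i]
  have hu0 : u z ≠ 0 := fun h => hF0 (by rw [hvec, h, zero_smul])
  have hsum : (∑ i, ∑ j ∈ Finset.Ioi i,
      ‖deriv (fun w => F w i) z * F z j - F z i * deriv (fun w => F w j) z‖ ^ 2)
      = (‖u z‖ ^ 2) ^ 2 * ∑ i, ∑ j ∈ Finset.Ioi i,
      ‖deriv (fun w => G w i) z * G z j - G z i * deriv (fun w => G w j) z‖ ^ 2 := by
    simp only [Finset.mul_sum]
    refine Finset.sum_congr rfl fun i _ => Finset.sum_congr rfl fun j _ => ?_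
    have : deriv (fun w => F w i) z * F z j - F z i * deriv (fun w => F w j) z
        = u z ^ 2 * (deriv (fun w => G w i) z * G z j - G z i * deriv (fun w => G w j) z) := by
      rw [hder, hder, hval, hval]; ring
    rw [this, norm_mul, norm_pow, mul_pow]
  have hpos : ‖u z‖ ^ 2 ≠ 0 := by positivity
  unfold repSphericalDeriv
  rw [hsum, Real.sqrt_mul (by positivity), Real.sqrt_sq (by positivity), hvec, norm_smul, mul_pow]
  exact mul_div_mul_left _ _ hpos

theorem sphericalDeriv_eq {n : ℕ} {f : ℂ → PSpace n}
    {F : ℂ → EuclideanSpace ℂ (Fin (n + 1))} {z : ℂ} (hF : IsReducedRepAt f F z) :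
    sphericalDeriv f z = repSphericalDeriv F z := by
  have h : ∃ F, IsReducedRepAt f F z := ⟨F, hF⟩
  rw [sphericalDeriv, dif_pos h]
  exact repSphericalDeriv_congr h.choose_spec hF

/-- A normal curve `ℂ → ℙⁿ`: a holomorphic curve whose spherical derivative is bounded. -/
def IsNormalCurve {n : ℕ} (f : ℂ → PSpace n) : Prop :=
  IsHolomorphicCurve f ∧ BddAbove (Set.range (sphericalDeriv f))

/-- The class of normal curves `f : ℂ → ℙⁿ` with `sup f^# ≤ M`. -/
def normalClass (n : ℕ) (M : ℝ) : Set (ℂ → PSpace n) :=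
  {f | IsNormalCurve f ∧ ∀ z, sphericalDeriv f z ≤ M}

/-- `E` is `K`-sparse: distinct points of `E` are at distance at least `K`. -/
def IsSparse (K : ℝ) (E : Set ℂ) : Prop :=
  E.Pairwise fun z w => K ≤ dist z w

end NormalCurves

/-! After rescaling, the points `x i` may be taken as far apart as desired. The affine coordinates
of the curve are sums over `i` of atoms `(p + s w) / (d + w ^ 4)`, `w = z - x i`: the decay `|w|⁻³`
is summable over separated points of the plane, so near `x i` all the other atoms together
contribute only a small `η` (`exists_packing_bound`, `norm_atomSum_le`).

Multiplying by the denominator `D` of the `i`-th atom gives homogeneous coordinates `(D, P j + D * η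
j)` near `x i`, regular even where `D` vanishes. The target is normalized so that its largest
coordinate is `1`, and `d` is its zeroth coordinate. The others are matched by solving for all `p`
at once; since `η` is small, this system is a small perturbation of the identity
(`exists_interpolating_coefficients`).

A bound on the spherical derivative needs these coordinates to stay away from `0`. The slope `s`,
either `4` or `0`, keeps some numerator large wherever `D` is small
(`one_eighth_le_norm_of_coordinates`). Away from all `x i`, the coordinates `(1, η)` serve. -/

namespace NormalCurves

/-! ### Inverse cubes over separated points -/

/-- A summable majorant on `ℤ²` for inverse cubes of norms of separated points. -/
noncomputable def latticeWeight (x : Fin 2 → ℤ) : ℝ :=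
  ‖x‖ ^ (-3 : ℝ) + Pi.single (M := fun _ : Fin 2 → ℤ => ℝ) 0 1 x

theorem latticeWeight_nonneg (x : Fin 2 → ℤ) : 0 ≤ latticeWeight x := by
  have h : 0 ≤ Pi.single (M := fun _ : Fin 2 → ℤ => ℝ) 0 1 x := by
    by_cases hx : x = 0
    · subst hx; simp
    · simp [hx]
  exact add_nonneg (by positivity) h

theorem summable_latticeWeight : Summable latticeWeight :=
  (EisensteinSeries.summable_one_div_norm_rpow (by norm_num)).add
    (hasSum_pi_single (0 : Fin 2 → ℤ) (1 : ℝ)).summable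

/-- The cell of the square grid of mesh `ρ / 2` containing `y`. -/
noncomputable def gridCell (ρ : ℝ) (y : ℂ) : Fin 2 → ℤ :=
  ![⌊2 * y.re / ρ⌋, ⌊2 * y.im / ρ⌋]

theorem dist_lt_of_gridCell_eq {ρ : ℝ} (hρ : 0 < ρ) {y w : ℂ}
    (h : gridCell ρ y = gridCell ρ w) : dist y w < ρ := by
  have h0 : ⌊2 * y.re / ρ⌋ = ⌊2 * w.re / ρ⌋ := congrFun h 0
  have h1 : ⌊2 * y.im / ρ⌋ = ⌊2 * w.im / ρ⌋ := congrFun h 1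
  have hr := Int.abs_sub_lt_one_of_floor_eq_floor h0
  have hi := Int.abs_sub_lt_one_of_floor_eq_floor h1
  have scale : ∀ a b : ℝ, |2 * a / ρ - 2 * b / ρ| < 1 → |a - b| < ρ / 2 := by
    intro a b hab
    have : 2 * a / ρ - 2 * b / ρ = (a - b) * (2 / ρ) := by ring
    rw [this, abs_mul, abs_of_pos (by positivity : 0 < 2 / ρ), ← lt_div_iff₀ (by positivity)] at hab
    simpa using hab
  rw [Complex.dist_eq]
  have := Complex.norm_le_abs_re_add_abs_im (y - w)
  rw [Complex.sub_re, Complex.sub_im] at this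
  linarith [scale _ _ hr, scale _ _ hi]

theorem norm_gridCell_le {ρ : ℝ} (hρ : 0 < ρ) (y : ℂ) : ‖gridCell ρ y‖ ≤ 2 * ‖y‖ / ρ + 1 := by
  have floor_bound : ∀ a : ℝ, |a| ≤ ‖y‖ → ‖⌊2 * a / ρ⌋‖ ≤ 2 * ‖y‖ / ρ + 1 := by
    intro a ha
    have h1 : |2 * a / ρ| ≤ 2 * ‖y‖ / ρ := by
      rw [abs_div, abs_mul, abs_of_pos hρ, abs_two]; gcongr
    have h2 := Int.floor_le (2 * a / ρ)
    have h3 := Int.lt_floor_add_one (2 * a / ρ)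
    rw [Int.norm_eq_abs, abs_le]
    rw [abs_le] at h1
    constructor <;> linarith [h1.1, h1.2]
  rw [pi_norm_le_iff_of_nonneg (by positivity)]
  intro i
  fin_cases i
  · exact floor_bound _ (Complex.abs_re_le_norm y)
  · exact floor_bound _ (Complex.abs_im_le_norm y)

theorem inv_norm_pow_le_latticeWeight {ρ : ℝ} (hρ : 0 < ρ) {y : ℂ} (hy : ρ ≤ ‖y‖) :
    (‖y‖ ^ 3)⁻¹ ≤ 27 / ρ ^ 3 * latticeWeight (gridCell ρ y) := by
  have hy0 : 0 < ‖y‖ := hρ.trans_le hy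
  by_cases hx : gridCell ρ y = 0
  · have h1 : (1 : ℝ) ≤ latticeWeight (gridCell ρ y) := by
      rw [hx]; simp [latticeWeight]
    calc (‖y‖ ^ 3)⁻¹ ≤ (ρ ^ 3)⁻¹ := by gcongr
      _ ≤ 27 / ρ ^ 3 * 1 := by
        rw [mul_one, ← one_div]; gcongr; norm_num
      _ ≤ _ := by gcongr
  · have hN : 0 < ‖gridCell ρ y‖ := norm_pos_iff.2 hx
    have h1 : ‖gridCell ρ y‖ ≤ 3 * ‖y‖ / ρ := by
      have h2 := norm_gridCell_le hρ y
      have h3 : 1 ≤ ‖y‖ / ρ := by rwa [le_div_iff₀ hρ, one_mul]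
      have h4 : 3 * ‖y‖ / ρ = 2 * ‖y‖ / ρ + ‖y‖ / ρ := by ring
      linarith
    have h2 : latticeWeight (gridCell ρ y) = (‖gridCell ρ y‖ ^ 3)⁻¹ := by
      have : (-3 : ℝ) = -((3 : ℕ) : ℝ) := by norm_num
      rw [latticeWeight, Pi.single_eq_of_ne hx, add_zero, this, Real.rpow_neg hN.le,
        Real.rpow_natCast]
    rw [h2]
    calc (‖y‖ ^ 3)⁻¹ = 27 / ρ ^ 3 * ((3 * ‖y‖ / ρ) ^ 3)⁻¹ := by field_simp; norm_num
      _ ≤ _ := by gcongr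

/-- `C` bounds, up to scaling, the sum of the inverse cubes of the norms of separated points. -/
def IsPackingBound (C : ℝ) : Prop :=
  ∀ (ι : Type) (S : Set ι) (y : ι → ℂ) (ρ : ℝ),
    0 < ρ → (S.Pairwise fun i j => ρ ≤ dist (y i) (y j)) → (∀ i ∈ S, ρ ≤ ‖y i‖) →
    Summable (S.indicator fun i => (‖y i‖ ^ 3)⁻¹) ∧
      ∑' i, S.indicator (fun i => (‖y i‖ ^ 3)⁻¹) i ≤ C / ρ ^ 3

/-- The inverse cubes of the distances to separated points have a sum bounded independently of the
points. -/
theorem exists_packing_bound : ∃ C : ℝ, 0 < C ∧ IsPackingBound C := by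
  refine ⟨27 * (∑' x, latticeWeight x) + 1,
    by have := tsum_nonneg (L := .unconditional _) latticeWeight_nonneg; positivity,
    fun ι S y ρ hρ hsep hy => ?_⟩
  -- A cell has side `ρ / 2`, hence diameter below `ρ`, and holds at most one of the points.
  have inj : Function.Injective fun i : S => gridCell ρ (y i) := by
    intro i j hij
    by_contra hne
    exact (hsep i.2 j.2 (fun h => hne (Subtype.ext h))).not_gt (dist_lt_of_gridCell_eq hρ hij)
  have hs := (summable_latticeWeight.comp_injective inj).mul_left (27 / ρ ^ 3)
  have hle : ∀ i : S, (‖y i‖ ^ 3)⁻¹ ≤ 27 / ρ ^ 3 * latticeWeight (gridCell ρ (y i)) :=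
    fun i => inv_norm_pow_le_latticeWeight hρ (hy i i.2)
  have hsum : Summable fun i : S => (‖y i‖ ^ 3)⁻¹ :=
    Summable.of_nonneg_of_le (fun i => by positivity) hle hs
  refine ⟨summable_subtype_iff_indicator.1 hsum, ?_⟩
  rw [← tsum_subtype]
  calc ∑' i : S, (‖y i‖ ^ 3)⁻¹
      ≤ ∑' i : S, 27 / ρ ^ 3 * latticeWeight (gridCell ρ (y i)) := hsum.tsum_le_tsum hle hs
    _ = 27 / ρ ^ 3 * ∑' i : S, latticeWeight (gridCell ρ (y i)) := tsum_mul_left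
    _ ≤ 27 / ρ ^ 3 * ∑' x, latticeWeight x := by
        gcongr
        exact tsum_comp_le_tsum_of_inj summable_latticeWeight latticeWeight_nonneg inj
    _ ≤ _ := by
        rw [div_mul_eq_mul_div]; gcongr; linarith

/-! ### Infinite linear systems -/

/-- A linear system `p + A p = c` with `c` bounded and `A` of row sums at most `1 / 2` has a bounded
solution. -/
theorem exists_solution_of_row_sums_le {ι : Type*} (A : ι → ι → ℂ) (c : ι → ℂ) (B : ℝ)
    (hc : ∀ i, ‖c i‖ ≤ B) (hA : ∀ i, Summable fun j => ‖A i j‖)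
    (hA' : ∀ i, ∑' j, ‖A i j‖ ≤ 1 / 2) :
    ∃ p : ι → ℂ, (∀ i, ‖p i‖ ≤ 2 * B) ∧ (∀ i, Summable fun j => A i j * p j) ∧
      ∀ i, p i + ∑' j, A i j * p j = c i := by
  let _ : TopologicalSpace ι := ⊥
  have : DiscreteTopology ι := ⟨rfl⟩
  have hterm : ∀ (p : BoundedContinuousFunction ι ℂ) i j, ‖A i j * p j‖ ≤ ‖A i j‖ * ‖p‖ := by
    intro p i j
    rw [norm_mul]
    gcongr
    exact p.norm_coe_le_norm j
  have hsum : ∀ (p : BoundedContinuousFunction ι ℂ) i, Summable fun j => A i j * p j :=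
    fun p i => Summable.of_norm_bounded ((hA i).mul_right ‖p‖) (hterm p i)
  have hbd : ∀ (p : BoundedContinuousFunction ι ℂ) i, ‖∑' j, A i j * p j‖ ≤ 1 / 2 * ‖p‖ := by
    intro p i
    refine (tsum_of_norm_bounded ((hA i).mul_right ‖p‖).hasSum (hterm p i)).trans ?_
    rw [tsum_mul_right]
    gcongr
    exact hA' i
  let T : BoundedContinuousFunction ι ℂ → BoundedContinuousFunction ι ℂ := fun p =>
    BoundedContinuousFunction.ofNormedAddCommGroupDiscrete (fun i => c i - ∑' j, A i j * p j)
      (B + 1 / 2 * ‖p‖) fun i => (norm_sub_le _ _).trans (add_le_add (hc i) (hbd p i))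
  -- The solution is the fixed point of `p ↦ c - A p` on the Banach space of bounded functions.
  have hT : ContractingWith (1 / 2) T := by
    refine ⟨by norm_num, LipschitzWith.of_dist_le_mul fun p q => ?_⟩
    rw [BoundedContinuousFunction.dist_le (by positivity)]
    intro i
    have : T p i - T q i = ∑' j, A i j * (q - p) j := by
      simp only [T, BoundedContinuousFunction.coe_ofNormedAddCommGroupDiscrete,
        BoundedContinuousFunction.coe_sub, Pi.sub_apply, mul_sub]
      rw [(hsum q i).tsum_sub (hsum p i)]
      ring
    rw [dist_eq_norm, this, dist_comm, dist_eq_norm]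
    simpa using hbd (q - p) i
  obtain ⟨p, hp⟩ : ∃ p, T p = p := ⟨_, hT.fixedPoint_isFixedPt⟩
  have heq : ∀ i, c i - ∑' j, A i j * p j = p i := fun i => congrFun (congrArg DFunLike.coe hp) i
  refine ⟨p, fun i => ?_, hsum p, fun i => by rw [← heq i]; ring⟩
  have hB : 0 ≤ B := (norm_nonneg _).trans (hc i)
  have hnorm : ‖p‖ ≤ B + 1 / 2 * ‖p‖ := by
    rw [BoundedContinuousFunction.norm_le (by positivity)]
    intro i
    rw [← heq i]
    exact (norm_sub_le _ _).trans (add_le_add (hc i) (hbd p i))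
  linarith [p.norm_coe_le_norm i]

/-! ### Atoms and their sums -/

/-- The rational function `(p + s z) / (d + z ^ 4)`. -/
noncomputable def atom (d p s z : ℂ) : ℂ := (p + s * z) / (d + z ^ 4)

theorem half_norm_pow_le_norm_denom {d z : ℂ} (hd : ‖d‖ ≤ 1) (hz : 2 ≤ ‖z‖) :
    ‖z‖ ^ 4 / 2 ≤ ‖d + z ^ 4‖ := by
  have h1 : ‖z ^ 4‖ ≤ ‖d + z ^ 4‖ + ‖d‖ := by
    have := norm_sub_le_norm_add (z ^ 4) d
    rw [add_comm (z ^ 4)] at this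
    linarith
  have h2 : (2 : ℝ) ^ 4 ≤ ‖z‖ ^ 4 := by gcongr
  rw [norm_pow] at h1
  linarith

theorem denom_ne_zero {d z : ℂ} (hd : ‖d‖ ≤ 1) (hz : 2 ≤ ‖z‖) : d + z ^ 4 ≠ 0 := by
  have h : 0 < ‖z‖ := by linarith
  exact norm_pos_iff.1 ((by positivity : 0 < ‖z‖ ^ 4 / 2).trans_le (half_norm_pow_le_norm_denom hd hz))

theorem norm_atom_le {d p s z : ℂ} (hd : ‖d‖ ≤ 1) (hp : ‖p‖ ≤ 3) (hs : ‖s‖ ≤ 4) (hz : 2 ≤ ‖z‖) :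
    ‖atom d p s z‖ ≤ 12 * (‖z‖ ^ 3)⁻¹ := by
  have h0 : 0 < ‖z‖ := by linarith
  have h1 : ‖p + s * z‖ ≤ 6 * ‖z‖ := by
    refine (norm_add_le _ _).trans ?_
    rw [norm_mul]
    nlinarith
  rw [atom, norm_div]
  calc ‖p + s * z‖ / ‖d + z ^ 4‖ ≤ 6 * ‖z‖ / (‖z‖ ^ 4 / 2) := by
        gcongr
        exact half_norm_pow_le_norm_denom hd hz
    _ = 12 * (‖z‖ ^ 3)⁻¹ := by field_simp; norm_num

/-- The sum of the atoms with poles near the points `x i`, `i ∈ S`. -/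
noncomputable def atomSum {ι : Type} (S : Set ι) (x d p s : ι → ℂ) (z : ℂ) : ℂ :=
  ∑' i, S.indicator (fun i => atom (d i) (p i) (s i) (z - x i)) i

section

variable {ι : Type} {S : Set ι} {x d p s : ι → ℂ} {C ρ : ℝ} {z w : ℂ}

theorem norm_indicator_atom_le (hd : ∀ i, ‖d i‖ ≤ 1) (hp : ∀ i, ‖p i‖ ≤ 3) (hs : ∀ i, ‖s i‖ ≤ 4)
    (hρ : 3 ≤ ρ) (hS : ∀ i ∈ S, ρ ≤ ‖z - x i‖) (hw : w ∈ Metric.ball z 1) (i : ι) :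
    ‖S.indicator (fun i => atom (d i) (p i) (s i) (w - x i)) i‖ ≤
      41 * S.indicator (fun i => (‖z - x i‖ ^ 3)⁻¹) i := by
  by_cases hi : i ∈ S
  · rw [Set.indicator_of_mem hi, Set.indicator_of_mem hi]
    have h1 := hρ.trans (hS i hi)
    -- Moving by less than `1` loses at most a third of a distance that is at least `3`; then `12 *
    -- (3 / 2) ^ 3 = 81 / 2` is rounded up to `41`.
    have h2 : 2 / 3 * ‖z - x i‖ ≤ ‖w - x i‖ := by
      have h3 := norm_sub_le_norm_sub_add_norm_sub z w (x i)
      rw [mem_ball_iff_norm'] at hw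
      linarith
    refine (norm_atom_le (hd i) (hp i) (hs i) (by linarith)).trans ?_
    calc 12 * (‖w - x i‖ ^ 3)⁻¹ ≤ 12 * ((2 / 3 * ‖z - x i‖) ^ 3)⁻¹ := by gcongr
      _ = 81 / 2 * (‖z - x i‖ ^ 3)⁻¹ := by field_simp; norm_num
      _ ≤ _ := by gcongr; norm_num
  · simp [hi]

theorem summable_and_tsum_majorant_le (hC : IsPackingBound C) (hρ : 3 ≤ ρ)
    (hsep : S.Pairwise fun i j => ρ ≤ dist (x i) (x j)) (hS : ∀ i ∈ S, ρ ≤ ‖z - x i‖) :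
    Summable (fun i => 41 * S.indicator (fun i => (‖z - x i‖ ^ 3)⁻¹) i) ∧
      ∑' i, 41 * S.indicator (fun i => (‖z - x i‖ ^ 3)⁻¹) i ≤ 41 * (C / ρ ^ 3) := by
  obtain ⟨h1, h2⟩ := hC ι S (fun i => z - x i) ρ (by linarith)
    (fun i hi j hj hij => (hsep hi hj hij).trans_eq (dist_sub_left _ _ _).symm) hS
  refine ⟨h1.mul_left _, ?_⟩
  rw [tsum_mul_left]
  gcongr

theorem summable_atomSum (hC : IsPackingBound C) (hd : ∀ i, ‖d i‖ ≤ 1) (hp : ∀ i, ‖p i‖ ≤ 3)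
    (hs : ∀ i, ‖s i‖ ≤ 4) (hρ : 3 ≤ ρ) (hsep : S.Pairwise fun i j => ρ ≤ dist (x i) (x j))
    (hS : ∀ i ∈ S, ρ ≤ ‖z - x i‖) (hw : w ∈ Metric.ball z 1) :
    Summable (S.indicator fun i => atom (d i) (p i) (s i) (w - x i)) :=
  Summable.of_norm_bounded (summable_and_tsum_majorant_le hC hρ hsep hS).1
    (norm_indicator_atom_le hd hp hs hρ hS hw)

theorem norm_atomSum_le (hC : IsPackingBound C) (hd : ∀ i, ‖d i‖ ≤ 1) (hp : ∀ i, ‖p i‖ ≤ 3)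
    (hs : ∀ i, ‖s i‖ ≤ 4) (hρ : 3 ≤ ρ) (hsep : S.Pairwise fun i j => ρ ≤ dist (x i) (x j))
    (hS : ∀ i ∈ S, ρ ≤ ‖z - x i‖) (hw : w ∈ Metric.ball z 1) :
    ‖atomSum S x d p s w‖ ≤ 41 * (C / ρ ^ 3) :=
  have h := summable_and_tsum_majorant_le hC hρ hsep hS
  (tsum_of_norm_bounded h.1.hasSum (norm_indicator_atom_le hd hp hs hρ hS hw)).trans h.2

theorem differentiableOn_atomSum (hC : IsPackingBound C) (hd : ∀ i, ‖d i‖ ≤ 1)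
    (hp : ∀ i, ‖p i‖ ≤ 3) (hs : ∀ i, ‖s i‖ ≤ 4) (hρ : 3 ≤ ρ)
    (hsep : S.Pairwise fun i j => ρ ≤ dist (x i) (x j)) (hS : ∀ i ∈ S, ρ ≤ ‖z - x i‖) :
    DifferentiableOn ℂ (atomSum S x d p s) (Metric.ball z 1) := by
  refine Complex.differentiableOn_tsum_of_summable_norm
    (summable_and_tsum_majorant_le hC hρ hsep hS).1 (fun i => ?_) Metric.isOpen_ball
    fun i w hw => norm_indicator_atom_le hd hp hs hρ hS hw i
  by_cases hi : i ∈ S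
  · simp only [Set.indicator_of_mem hi, atom]
    intro w hw
    refine DifferentiableAt.differentiableWithinAt (DifferentiableAt.div (by fun_prop)
      (by fun_prop) (denom_ne_zero (hd i) ?_))
    have h3 := norm_sub_le_norm_sub_add_norm_sub z w (x i)
    rw [mem_ball_iff_norm'] at hw
    linarith [hS i hi]
  · simp only [Set.indicator_of_notMem hi]
    exact differentiableOn_const 0

/-- Cauchy's estimate on the circle of radius `1 / 2`, which doubles the bound for the sum. -/
theorem norm_deriv_atomSum_le (hC : IsPackingBound C) (hd : ∀ i, ‖d i‖ ≤ 1)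
    (hp : ∀ i, ‖p i‖ ≤ 3) (hs : ∀ i, ‖s i‖ ≤ 4) (hρ : 3 ≤ ρ)
    (hsep : S.Pairwise fun i j => ρ ≤ dist (x i) (x j)) (hS : ∀ i ∈ S, ρ ≤ ‖z - x i‖) :
    ‖deriv (atomSum S x d p s) z‖ ≤ 82 * (C / ρ ^ 3) := by
  have hsub : Metric.closedBall z (1 / 2) ⊆ Metric.ball z 1 :=
    Metric.closedBall_subset_ball (by norm_num)
  have h := Complex.norm_deriv_le_of_forall_mem_sphere_norm_le (by norm_num : (0 : ℝ) < 1 / 2)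
    (((differentiableOn_atomSum hC hd hp hs hρ hsep hS).mono hsub).diffContOnCl_ball subset_rfl)
    (fun w hw => norm_atomSum_le hC hd hp hs hρ hsep hS (hsub (Metric.sphere_subset_closedBall hw)))
  linarith

end

/-- Coefficients `p` may be chosen so that the sum of atoms, multiplied by the denominator of the
`i`-th atom, takes prescribed values at all the points `x i`. -/
theorem exists_interpolating_coefficients {ι : Type} {x d s : ι → ℂ} (a : ι → ℂ) {C ρ : ℝ}
    (hC : IsPackingBound C) (hd : ∀ i, ‖d i‖ ≤ 1) (hs : ∀ i, ‖s i‖ ≤ 4) (ha : ∀ i, ‖a i‖ ≤ 1)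
    (hρ : 3 ≤ ρ) (hsmall : 41 * (C / ρ ^ 3) ≤ 1 / 8)
    (hsep : Pairwise fun i j => ρ ≤ dist (x i) (x j)) :
    ∃ p : ι → ℂ, (∀ i, ‖p i‖ ≤ 3) ∧
      ∀ i, p i + d i * atomSum {i}ᶜ x d p s (x i) = a i := by
  have hsep' : ∀ S : Set ι, S.Pairwise fun i j => ρ ≤ dist (x i) (x j) :=
    fun S i _ j _ hij => hsep hij
  have hS : ∀ i, ∀ j ∈ ({i}ᶜ : Set ι), ρ ≤ ‖x i - x j‖ := fun i j hj => by
    rw [← dist_eq_norm]; exact hsep (Ne.symm hj)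
  have hball : ∀ z : ℂ, z ∈ Metric.ball z 1 := fun z => Metric.mem_ball_self one_pos
  -- Atoms are affine in `p`: `A i j` is the coefficient of `p j`, and the part with `p = 0` moves
  -- to the right-hand side, which is then bounded by `1 + 1 / 8`.
  let A : ι → ι → ℂ := fun i j =>
    d i * ({i}ᶜ : Set ι).indicator (fun j => atom (d j) 1 0 (x i - x j)) j
  have hAle : ∀ i j, ‖A i j‖ ≤
      41 * ({i}ᶜ : Set ι).indicator (fun j => (‖x i - x j‖ ^ 3)⁻¹) j := by
    intro i j
    have h := norm_indicator_atom_le (p := fun _ => 1) (s := fun _ => 0) hd (by simp) (by simp) hρ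
      (hS i) (hball _) j
    rw [norm_mul]
    exact (mul_le_of_le_one_left (norm_nonneg _) (hd i)).trans h
  have hmaj := fun i => summable_and_tsum_majorant_le hC hρ (hsep' {i}ᶜ) (hS i)
  have hA : ∀ i, Summable fun j => ‖A i j‖ := fun i =>
    Summable.of_nonneg_of_le (fun j => norm_nonneg _) (hAle i) (hmaj i).1
  have hs0 := fun i => summable_atomSum (p := fun _ => 0) hC hd (by simp) hs hρ (hsep' {i}ᶜ) (hS i)
    (hball _)
  have h0 := fun i => norm_atomSum_le (p := fun _ => 0) hC hd (by simp) hs hρ (hsep' {i}ᶜ) (hS i)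
    (hball _)
  obtain ⟨p, hp, hpsum, hpeq⟩ := exists_solution_of_row_sums_le A
    (fun i => a i - d i * atomSum {i}ᶜ x d (fun _ => 0) s (x i)) (9 / 8)
    (fun i => by
      refine (norm_sub_le _ _).trans ?_
      rw [norm_mul]
      have := mul_le_of_le_one_left (norm_nonneg (atomSum {i}ᶜ x d (fun _ => 0) s (x i))) (hd i)
      linarith [ha i, h0 i])
    hA (fun i => ((hA i).tsum_le_tsum (hAle i) (hmaj i).1).trans (by linarith [(hmaj i).2]))
  refine ⟨p, fun i => (hp i).trans (by norm_num), fun i => ?_⟩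
  have hsplit : d i * atomSum {i}ᶜ x d p s (x i) =
      ∑' j, A i j * p j + d i * atomSum {i}ᶜ x d (fun _ => 0) s (x i) := by
    rw [atomSum, atomSum, ← tsum_mul_left, ← tsum_mul_left,
      ← (hpsum i).tsum_add ((hs0 i).mul_left (d i))]
    refine tsum_congr fun j => ?_
    by_cases hj : j ∈ ({i}ᶜ : Set ι)
    · simp only [A, Set.indicator_of_mem hj, atom]
      ring
    · simp [A, Set.indicator_of_notMem hj]
  rw [hsplit, ← add_assoc, hpeq i]
  ring

/-! ### Homogeneous coordinates and their bounds -/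

/-- Each minor is at most `2 * B * ‖F z‖`, so one factor `‖F z‖` cancels and no upper bound on `F`
is needed. -/
theorem repSphericalDeriv_le {n : ℕ} {F : ℂ → EuclideanSpace ℂ (Fin (n + 1))} {z : ℂ} {c B : ℝ}
    (hc : 0 < c) (hF : c ≤ ‖F z‖) (hB : ∀ i, ‖deriv (fun w => F w i) z‖ ≤ B) :
    repSphericalDeriv F z ≤ 2 * (n + 1) * B / c := by
  have hB0 : 0 ≤ B := (norm_nonneg _).trans (hB 0)
  have hF0 : 0 < ‖F z‖ := hc.trans_le hF
  have hterm : ∀ i j : Fin (n + 1),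
      ‖deriv (fun w => F w i) z * F z j - F z i * deriv (fun w => F w j) z‖ ^ 2 ≤
        (2 * B * ‖F z‖) ^ 2 := by
    intro i j
    gcongr
    refine (norm_sub_le _ _).trans ?_
    rw [norm_mul, norm_mul]
    have h1 : ‖deriv (fun w => F w i) z‖ * ‖F z j‖ ≤ B * ‖F z‖ := by
      gcongr
      exacts [hB i, PiLp.norm_apply_le _ j]
    have h2 : ‖F z i‖ * ‖deriv (fun w => F w j) z‖ ≤ ‖F z‖ * B := by
      gcongr
      exacts [PiLp.norm_apply_le _ i, hB j]
    linarith
  have hsum : (∑ i, ∑ j ∈ Finset.Ioi i,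
      ‖deriv (fun w => F w i) z * F z j - F z i * deriv (fun w => F w j) z‖ ^ 2) ≤
        ((n + 1) * (2 * B * ‖F z‖)) ^ 2 := by
    calc _ ≤ ∑ _i : Fin (n + 1), ∑ _j : Fin (n + 1), (2 * B * ‖F z‖) ^ 2 := by
          gcongr with i
          exact (Finset.sum_le_sum fun j _ => hterm i j).trans
            (Finset.sum_le_sum_of_subset_of_nonneg (Finset.subset_univ _)
              fun _ _ _ => by positivity)
      _ = _ := by
          simp only [Finset.sum_const, Finset.card_univ, Fintype.card_fin, nsmul_eq_mul]
          push_cast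
          ring
  rw [repSphericalDeriv]
  calc _ ≤ ((n + 1) * (2 * B * ‖F z‖)) / ‖F z‖ ^ 2 := by
        gcongr
        exact Real.sqrt_le_iff.2 ⟨by positivity, hsum⟩
    _ = 2 * (n + 1) * B / ‖F z‖ := by field_simp
    _ ≤ _ := by gcongr

/-- The vector with homogeneous coordinates `D` and `P j + D η j`, representing the curve with affine
coordinates `P j / D + η j`. -/
noncomputable def homRep {n : ℕ} (D : ℂ → ℂ) (P η : Fin n → ℂ → ℂ) (z : ℂ) :
    EuclideanSpace ℂ (Fin (n + 1)) :=
  WithLp.toLp 2 (Fin.cons (D z) fun j => P j z + D z * η j z)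

section

variable {n : ℕ} {D : ℂ → ℂ} {P η : Fin n → ℂ → ℂ} {z : ℂ}

@[simp]
theorem homRep_zero : homRep D P η z 0 = D z := rfl

@[simp]
theorem homRep_succ (j : Fin n) : homRep D P η z j.succ = P j z + D z * η j z := rfl

theorem differentiableAt_homRep (hD : DifferentiableAt ℂ D z)
    (hP : ∀ j, DifferentiableAt ℂ (P j) z) (hη : ∀ j, DifferentiableAt ℂ (η j) z) :
    DifferentiableAt ℂ (homRep D P η) z := by
  rw [differentiableAt_euclidean]
  intro i
  refine Fin.cases ?_ (fun j => ?_) i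
  · exact hD
  · exact (hP j).add (hD.mul (hη j))

theorem norm_deriv_homRep_le {B : ℝ} (hD : DifferentiableAt ℂ D z)
    (hP : ∀ j, DifferentiableAt ℂ (P j) z) (hη : ∀ j, DifferentiableAt ℂ (η j) z)
    (hB : ‖deriv D z‖ ≤ B)
    (hB' : ∀ j, ‖deriv (P j) z‖ + (‖deriv D z‖ * ‖η j z‖ + ‖D z‖ * ‖deriv (η j) z‖) ≤ B)
    (i : Fin (n + 1)) : ‖deriv (fun w => homRep D P η w i) z‖ ≤ B := by
  refine Fin.cases ?_ (fun j => ?_) i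
  · exact hB
  · have h : deriv (fun w => homRep D P η w j.succ) z =
        deriv (P j) z + (deriv D z * η j z + D z * deriv (η j) z) := by
      simp only [homRep_succ]
      exact ((hP j).hasDerivAt.add (hD.hasDerivAt.mul (hη j).hasDerivAt)).deriv
    rw [h]
    refine le_trans ((norm_add_le _ _).trans ?_) (hB' j)
    gcongr
    refine (norm_add_le _ _).trans ?_
    rw [norm_mul, norm_mul]

end

/-- Every point of projective space has homogeneous coordinates in the closed unit polydisc, one of
them equal to `1`. -/
theorem exists_normalized_rep {n : ℕ} (q : PSpace n) :
    ∃ (v : EuclideanSpace ℂ (Fin (n + 1))) (hv : v ≠ 0), q = Projectivization.mk ℂ v hv ∧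
      (∀ i, ‖v i‖ ≤ 1) ∧ ∃ k, v k = 1 := by
  obtain ⟨k, hk⟩ := Finite.exists_max fun i => ‖q.rep i‖
  have hk0 : q.rep k ≠ 0 := by
    intro h0
    refine q.rep_nonzero ?_
    ext i
    have := hk i
    rw [h0, norm_zero] at this
    simpa using norm_le_zero_iff.1 this
  have hv : (q.rep k)⁻¹ • q.rep ≠ 0 := smul_ne_zero (inv_ne_zero hk0) q.rep_nonzero
  refine ⟨(q.rep k)⁻¹ • q.rep, hv, ?_, fun i => ?_, k, ?_⟩
  · conv_lhs => rw [← q.mk_rep]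
    exact ((Projectivization.mk_eq_mk_iff' ℂ _ _ hv q.rep_nonzero).2 ⟨_, rfl⟩).symm
  · rw [PiLp.smul_apply, smul_eq_mul, norm_mul, norm_inv, inv_mul_le_iff₀ (norm_pos_iff.2 hk0),
      mul_one]
    exact hk i
  · rw [PiLp.smul_apply, smul_eq_mul, inv_mul_cancel₀ hk0]

/-- A lower bound for homogeneous coordinates `d + z ^ 4`, `p j + s z + (d + z ^ 4) e j` when `e` is
small. -/
theorem one_eighth_le_norm_of_coordinates {n : ℕ} {v : EuclideanSpace ℂ (Fin (n + 1))}
    {d s z : ℂ} {a p e : Fin n → ℂ} (hn : 0 < n) (ha : ∀ j, ‖a j‖ ≤ 1)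
    (hpa : ∀ j, ‖p j - a j‖ ≤ 1 / 8) (he : ∀ j, ‖e j‖ ≤ 1 / 8)
    (hcase : (d = 1 ∧ s = 4) ∨ (s = 0 ∧ ∃ j, a j = 1))
    (hv0 : v 0 = d + z ^ 4) (hv : ∀ j, v (Fin.succ j) = p j + s * z + (d + z ^ 4) * e j) :
    1 / 8 ≤ ‖v‖ := by
  rcases le_or_gt (1 / 8) ‖d + z ^ 4‖ with hD | hD
  · rw [← hv0] at hD
    exact hD.trans (PiLp.norm_apply_le v 0)
  have hsmall : ∀ j, ‖(d + z ^ 4) * e j‖ ≤ 1 / 8 := fun j => by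
    rw [norm_mul]
    nlinarith [he j, norm_nonneg (e j), norm_nonneg (d + z ^ 4)]
  have hcoord : ∀ j, ‖p j + s * z‖ - 1 / 8 ≤ ‖v‖ := fun j => by
    refine le_trans ?_ (PiLp.norm_apply_le v (Fin.succ j))
    rw [hv j]
    linarith [norm_sub_le_norm_add (p j + s * z) ((d + z ^ 4) * e j), hsmall j]
  rcases hcase with ⟨rfl, rfl⟩ | ⟨rfl, j, hj⟩
  -- Since `1 + z ^ 4` is small, `z` is not, and `4 * z` with norm at least `2` dominates `p j` with
  -- norm at most `9 / 8`.
  · have hz : 1 / 2 ≤ ‖z‖ := by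
      by_contra! hlt
      have h1 : ‖(1 : ℂ)‖ ≤ ‖1 + z ^ 4‖ + ‖z ^ 4‖ := by
        linarith [norm_sub_le_norm_add 1 (z ^ 4)]
      have h2 : ‖z ^ 4‖ ≤ 1 / 16 := by
        rw [norm_pow]
        exact (pow_le_pow_left₀ (norm_nonneg z) hlt.le 4).trans (by norm_num)
      rw [norm_one] at h1
      linarith
    let j : Fin n := ⟨0, hn⟩
    have h1 : ‖4 * z‖ ≤ ‖p j + 4 * z‖ + ‖p j‖ := by
      have := norm_sub_le_norm_add (4 * z) (p j)
      rw [add_comm (4 * z)] at this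
      linarith
    have h2 : ‖p j‖ ≤ ‖p j - a j‖ + ‖a j‖ := by
      simpa using norm_add_le (p j - a j) (a j)
    have h3 : ‖4 * z‖ = 4 * ‖z‖ := by simp
    linarith [hcoord j, ha j, hpa j]
  -- Here the numerator is the constant `p j`, within `1 / 8` of `a j = 1`.
  · have h1 : ‖a j‖ ≤ ‖p j‖ + ‖p j - a j‖ := by
      simpa using norm_sub_le (p j) (p j - a j)
    have h2 := hcoord j
    rw [hj, norm_one] at h1
    rw [zero_mul, add_zero] at h2
    have h3 := hpa j
    rw [hj] at h3
    linarith

theorem atomSum_univ_eq {ι : Type} {x d p s : ι → ℂ} {z : ℂ} (i : ι)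
    (h : Summable (({i}ᶜ : Set ι).indicator fun j => atom (d j) (p j) (s j) (z - x j))) :
    atomSum Set.univ x d p s z =
      atom (d i) (p i) (s i) (z - x i) + atomSum {i}ᶜ x d p s z := by
  classical
  have h1 := hasSum_pi_single i (atom (d i) (p i) (s i) (z - x i))
  rw [atomSum, atomSum, ← h1.tsum_eq, ← h1.summable.tsum_add h]
  refine tsum_congr fun j => ?_
  by_cases hj : j = i
  · subst hj; simp
  · simp [hj]

/-! ### Construction for widely separated points -/

/-- Prescribed values at sufficiently separated points are attained by a holomorphic curve whose
spherical derivative has a bound depending only on the dimension. -/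
theorem exists_curve_of_separated {n : ℕ} (hn : 0 < n) :
    ∃ ρ B : ℝ, 0 < ρ ∧ 0 < B ∧ ∀ (ι : Type) (x : ι → ℂ) (b : ι → PSpace n),
      (Pairwise fun i j => ρ ≤ dist (x i) (x j)) →
      ∃ f : ℂ → PSpace n,
        (∀ z, ∃ F, IsReducedRepAt f F z ∧ repSphericalDeriv F z ≤ B) ∧ ∀ i, f (x i) = b i := by
  obtain ⟨C, hC0, hC⟩ := exists_packing_bound
  obtain ⟨ρ, hρ3, hsmall⟩ : ∃ ρ : ℝ, 3 ≤ ρ ∧ C / ρ ^ 3 ≤ 1 / 328 := by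
    refine ⟨328 * C + 3, by linarith, ?_⟩
    have h1 : (1 : ℝ) ≤ 328 * C + 3 := by linarith
    have h2 : 328 * C + 3 ≤ (328 * C + 3) ^ 3 := le_self_pow₀ h1 (by norm_num)
    rw [div_le_div_iff₀ (by positivity) (by norm_num)]
    linarith
  -- The extra `3` keeps the disc of radius `3` about one point at distance `ρ` from the others. In
  -- the bound, `864 = 108 / (1 / 8)` serves these discs and the other term their complement.
  refine ⟨ρ + 3, 2 * (n + 1) * (864 + 82 * (C / 3 ^ 3)), by linarith, by positivity,
    fun ι x b hsep => ?_⟩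
  choose v hv hbv hv1 k hk using fun i => exists_normalized_rep (b i)
  let d : ι → ℂ := fun i => v i 0
  let s : ι → ℂ := fun i => if k i = 0 then 4 else 0
  have hd : ∀ i, ‖d i‖ ≤ 1 := fun i => hv1 i 0
  have hs : ∀ i, ‖s i‖ ≤ 4 := fun i => by
    by_cases h : k i = 0 <;> simp [s, h]
  have hcase : ∀ i, (d i = 1 ∧ s i = 4) ∨ (s i = 0 ∧ ∃ j : Fin n, v i j.succ = 1) := fun i => by
    by_cases h : k i = 0
    · exact Or.inl ⟨by rw [← hk i, h], by simp [s, h]⟩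
    · obtain ⟨j, hj⟩ := Fin.exists_succ_eq.2 h
      exact Or.inr ⟨by simp [s, h], j, by rw [hj, hk i]⟩
  have hsepρ : Pairwise fun i j => ρ ≤ dist (x i) (x j) := fun i j hij => by
    linarith [hsep hij]
  have hsepS : ∀ S : Set ι, S.Pairwise fun i j => ρ ≤ dist (x i) (x j) :=
    fun S i _ j _ hij => hsepρ hij
  choose p hp hpeq using fun j : Fin n => exists_interpolating_coefficients
    (fun i => v i j.succ) hC hd hs (fun i => hv1 i j.succ) hρ3 (by linarith) hsepρ
  have hfar : ∀ i z, ‖z - x i‖ < 3 → ∀ j ∈ ({i}ᶜ : Set ι), ρ ≤ ‖z - x j‖ := by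
    intro i z hz j hj
    have h1 : ρ + 3 ≤ dist (x i) (x j) := hsep (Ne.symm hj)
    rw [dist_eq_norm] at h1
    have h2 := norm_sub_le_norm_sub_add_norm_sub (x i) z (x j)
    rw [norm_sub_rev (x i) z] at h2
    linarith
  have hball : ∀ z : ℂ, z ∈ Metric.ball z 1 := fun z => Metric.mem_ball_self one_pos
  let η : Set ι → Fin n → ℂ → ℂ := fun S j => atomSum S x d (p j) s
  have hη : ∀ i z, ‖z - x i‖ < 3 → ∀ j, ‖η {i}ᶜ j z‖ ≤ 1 / 8 := fun i z hz j =>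
    (norm_atomSum_le hC hd (hp j) hs hρ3 (hsepS _) (hfar i z hz) (hball z)).trans (by linarith)
  have hη' : ∀ i z, ‖z - x i‖ < 3 → ∀ j, ‖deriv (η {i}ᶜ j) z‖ ≤ 1 / 4 := fun i z hz j =>
    (norm_deriv_atomSum_le hC hd (hp j) hs hρ3 (hsepS _) (hfar i z hz)).trans (by linarith)
  have hηdiff : ∀ i z, ‖z - x i‖ < 3 → ∀ j, DifferentiableAt ℂ (η {i}ᶜ j) z := fun i z hz j =>
    (differentiableOn_atomSum hC hd (hp j) hs hρ3 (hsepS _) (hfar i z hz)).differentiableAt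
      (Metric.ball_mem_nhds z one_pos)
  let D : ι → ℂ → ℂ := fun i z => d i + (z - x i) ^ 4
  let P : ι → Fin n → ℂ → ℂ := fun i j z => p j i + s i * (z - x i)
  have hDderiv : ∀ i z, HasDerivAt (D i) (4 * (z - x i) ^ 3) z := fun i z => by
    simpa [D] using (((hasDerivAt_id z).sub_const (x i)).pow 4).const_add (d i)
  have hPderiv : ∀ i j z, HasDerivAt (P i j) (s i) z := fun i j z => by
    simpa [P] using (((hasDerivAt_id z).sub_const (x i)).const_mul (s i)).const_add (p j i)
  let G : ι → ℂ → EuclideanSpace ℂ (Fin (n + 1)) := fun i => homRep (D i) (P i) (η {i}ᶜ)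
  let H : ℂ → EuclideanSpace ℂ (Fin (n + 1)) :=
    homRep (fun _ => 1) (fun _ _ => 0) (η Set.univ)
  have hx3 : ∀ i, ‖x i - x i‖ < 3 := fun i => by simp
  have hGlow : ∀ i z, ‖z - x i‖ < 3 → 1 / 8 ≤ ‖G i z‖ := fun i z hz => by
    refine one_eighth_le_norm_of_coordinates (p := fun j => p j i) (e := fun j => η {i}ᶜ j z) hn
      (fun j => hv1 i j.succ) (fun j => ?_) (hη i z hz) (hcase i) rfl (fun j => rfl)
    have h1 : p j i - v i j.succ = -(d i * η {i}ᶜ j (x i)) := by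
      rw [← hpeq j i]; ring
    rw [h1, norm_neg, norm_mul]
    exact (mul_le_of_le_one_left (norm_nonneg _) (hd i)).trans (hη i (x i) (hx3 i) j)
  have hG0 : ∀ i z, ‖z - x i‖ < 3 → G i z ≠ 0 := fun i z hz =>
    norm_pos_iff.1 (lt_of_lt_of_le (by norm_num) (hGlow i z hz))
  have hHlow : ∀ z, 1 ≤ ‖H z‖ := fun z => by
    simpa [H] using PiLp.norm_apply_le (H z) 0
  have hH0 : ∀ z, H z ≠ 0 := fun z => norm_pos_iff.1 (one_pos.trans_le (hHlow z))
  classical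
  let f : ℂ → PSpace n := fun z =>
    if h : ∃ i, ‖z - x i‖ < 3 then Projectivization.mk ℂ (G h.choose z) (hG0 _ z h.choose_spec)
    else Projectivization.mk ℂ (H z) (hH0 z)
  have hfG : ∀ i z (h : ‖z - x i‖ < 3), f z = Projectivization.mk ℂ (G i z) (hG0 i z h) := by
    intro i z h
    have hex : ∃ i, ‖z - x i‖ < 3 := ⟨i, h⟩
    have hi : hex.choose = i := by
      by_contra hne
      linarith [hfar i z h _ hne, hex.choose_spec]
    simp only [f, dif_pos hex, hi]
  -- On the overlap `2 < ‖z - x i‖ < 3` the two representations differ by the nonvanishing factor `D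
  -- i z`. The overlap lets `H` represent `f` on a whole unit ball about any point outside the
  -- discs.
  have hfH : ∀ z, (∀ i, 2 < ‖z - x i‖) → f z = Projectivization.mk ℂ (H z) (hH0 z) := by
    intro z hz
    by_cases hex : ∃ i, ‖z - x i‖ < 3
    · obtain ⟨i, hi⟩ := hex
      rw [hfG i z hi, Projectivization.mk_eq_mk_iff']
      refine ⟨D i z, ?_⟩
      have hD0 : d i + (z - x i) ^ 4 ≠ 0 := denom_ne_zero (hd i) (hz i).le
      ext l
      refine Fin.cases ?_ (fun j => ?_) l
      · simp [H, G]
      · have := atomSum_univ_eq i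
          (summable_atomSum hC hd (hp j) hs hρ3 (hsepS _) (hfar i z hi) (hball z))
        simp only [H, G, PiLp.smul_apply, homRep_succ, smul_eq_mul, η, this, D, P, atom]
        field_simp
        ring
    · simp only [f, dif_neg hex]
  refine ⟨f, fun z => ?_, fun i => ?_⟩
  · by_cases hex : ∃ i, ‖z - x i‖ < 3
    · obtain ⟨i, hi⟩ := hex
      refine ⟨G i, ?_, ?_⟩
      · have hopen : IsOpen {w : ℂ | ‖w - x i‖ < 3} := isOpen_lt (by fun_prop) (by fun_prop)
        filter_upwards [hopen.mem_nhds hi] with w hw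
        exact ⟨differentiableAt_homRep (hDderiv i w).differentiableAt
          (fun j => (hPderiv i j w).differentiableAt) (hηdiff i w hw), hG0 i w hw, hfG i w hw⟩
      · have hz3 : ‖z - x i‖ ^ 3 ≤ 3 ^ 3 := by gcongr
        have hz4 : ‖z - x i‖ ^ 4 ≤ 3 ^ 4 := by gcongr
        have hD' : ‖deriv (D i) z‖ ≤ 108 := by
          rw [(hDderiv i z).deriv, norm_mul, norm_pow, Complex.norm_ofNat]
          linarith
        have hDle : ‖D i z‖ ≤ 82 := by
          refine (norm_add_le _ _).trans ?_
          rw [norm_pow]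
          linarith [hd i]
        refine (repSphericalDeriv_le (B := 108) (by norm_num) (hGlow i z hi)
          (norm_deriv_homRep_le (hDderiv i z).differentiableAt
            (fun j => (hPderiv i j z).differentiableAt) (hηdiff i z hi) hD' fun j => ?_)).trans ?_
        · rw [(hPderiv i j z).deriv]
          have h1 : ‖deriv (D i) z‖ * ‖η {i}ᶜ j z‖ ≤ 108 * (1 / 8) := by
            gcongr
            exact hη i z hi j
          have h2 : ‖D i z‖ * ‖deriv (η {i}ᶜ j) z‖ ≤ 82 * (1 / 4) := by
            gcongr
            exact hη' i z hi j
          linarith [hs i]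
        · have : 0 ≤ 2 * ((n : ℝ) + 1) * (82 * (C / 3 ^ 3)) := by positivity
          linarith
    · push Not at hex
      have hS : ∀ i ∈ (Set.univ : Set ι), 3 ≤ ‖z - x i‖ := fun i _ => hex i
      have hsep3 : (Set.univ : Set ι).Pairwise fun i j => 3 ≤ dist (x i) (x j) :=
        fun i _ j _ hij => hρ3.trans (hsepρ hij)
      have hdiff : ∀ j, ∀ w ∈ Metric.ball z 1, DifferentiableAt ℂ (η Set.univ j) w :=
        fun j w hw => (differentiableOn_atomSum hC hd (hp j) hs le_rfl hsep3 hS).differentiableAt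
          (Metric.isOpen_ball.mem_nhds hw)
      refine ⟨H, ?_, ?_⟩
      · filter_upwards [Metric.ball_mem_nhds z one_pos] with w hw
        refine ⟨differentiableAt_homRep (by fun_prop) (fun j => by fun_prop)
          (fun j => hdiff j w hw), hH0 w, hfH w fun i => ?_⟩
        have h3 := norm_sub_le_norm_sub_add_norm_sub z w (x i)
        rw [mem_ball_iff_norm'] at hw
        linarith [hex i]
      · refine (repSphericalDeriv_le (B := 82 * (C / 3 ^ 3)) one_pos (hHlow z)
          (norm_deriv_homRep_le (by fun_prop) (fun j => by fun_prop)
            (fun j => hdiff j z (hball z)) ?_ fun j => ?_)).trans ?_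
        · simp only [deriv_const, norm_zero]
          positivity
        · simpa using norm_deriv_atomSum_le hC hd (hp j) hs le_rfl hsep3 hS
        · have : 0 ≤ 2 * ((n : ℝ) + 1) * 864 := by positivity
          linarith
  · rw [hfG i (x i) (hx3 i), hbv i]
    congr 1
    ext l
    refine Fin.cases ?_ (fun j => ?_) l
    · simp [G, D, d]
    · simpa [G, D, P, η] using hpeq j i

/-! ### Rescaling and conclusion -/

theorem IsReducedRepAt.comp_mul_left {n : ℕ} {f : ℂ → PSpace n}
    {F : ℂ → EuclideanSpace ℂ (Fin (n + 1))} {c z : ℂ} (h : IsReducedRepAt f F (c * z)) :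
    IsReducedRepAt (fun w => f (c * w)) (fun w => F (c * w)) z := by
  have hc : ContinuousAt (fun w : ℂ => c * w) z := by fun_prop
  filter_upwards [hc.eventually h] with w hw
  exact ⟨hw.1.comp w (by fun_prop), hw.2⟩

theorem repSphericalDeriv_comp_mul_left {n : ℕ} (F : ℂ → EuclideanSpace ℂ (Fin (n + 1))) (c z : ℂ) :
    repSphericalDeriv (fun w => F (c * w)) z = ‖c‖ * repSphericalDeriv F (c * z) := by
  have hder : ∀ i, deriv (fun w => F (c * w) i) z = c * deriv (fun w => F w i) (c * z) := fun i => by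
    simpa using deriv_comp_mul_left c (fun w => F w i) z
  have hterm : ∀ i j, ‖deriv (fun w => F (c * w) i) z * F (c * z) j -
      F (c * z) i * deriv (fun w => F (c * w) j) z‖ ^ 2 = ‖c‖ ^ 2 *
      ‖deriv (fun w => F w i) (c * z) * F (c * z) j -
        F (c * z) i * deriv (fun w => F w j) (c * z)‖ ^ 2 := fun i j => by
    rw [hder, hder, ← mul_pow, ← norm_mul]
    ring_nf
  simp only [repSphericalDeriv, hterm, ← Finset.mul_sum]
  rw [Real.sqrt_mul (by positivity), Real.sqrt_sq (norm_nonneg c), mul_div_assoc]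

theorem mem_normalClass {n : ℕ} {f : ℂ → PSpace n} {M : ℝ}
    (h : ∀ z, ∃ F, IsReducedRepAt f F z ∧ repSphericalDeriv F z ≤ M) : f ∈ normalClass n M := by
  have hle : ∀ z, sphericalDeriv f z ≤ M := fun z => by
    obtain ⟨F, hF, hM⟩ := h z
    rwa [sphericalDeriv_eq hF]
  refine ⟨⟨fun z => (h z).imp fun F hF => hF.1, M, ?_⟩, hle⟩
  rintro _ ⟨z, rfl⟩
  exact hle z

theorem subsingleton_PSpace_zero : Subsingleton (PSpace 0) := by
  refine ⟨fun q r => ?_⟩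
  obtain ⟨v, hv, rfl, -, k, hk⟩ := exists_normalized_rep q
  obtain ⟨w, hw, rfl, -, l, hl⟩ := exists_normalized_rep r
  congr 1
  ext i
  have hsub : ∀ i j : Fin (0 + 1), i = j := fun i j => Subsingleton.elim (α := Fin 1) i j
  rw [hsub i k, hk, hsub k l, hl]

theorem const_mem_normalClass {n : ℕ} (q : PSpace n) {M : ℝ} (hM : 0 ≤ M) :
    (fun _ => q) ∈ normalClass n M :=
  mem_normalClass fun z => ⟨fun _ => q.rep, Eventually.of_forall fun w =>
    ⟨differentiableAt_const _, q.rep_nonzero, q.mk_rep.symm⟩, by simpa [repSphericalDeriv] using hM⟩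

end NormalCurves

theorem theorem4 (n : ℕ) :
    ∃ C : ℝ, 0 < C ∧ ∀ K : ℝ, 0 < K → ∀ E : Set ℂ, NormalCurves.IsSparse K E →
      ∀ b : E → NormalCurves.PSpace n,
        ∃ f ∈ NormalCurves.normalClass n (C / K), ∀ m : E, f m = b m := by
  -- The construction needs an affine coordinate to carry the slope; `ℙ⁰` is a single point.
  rcases Nat.eq_zero_or_pos n with rfl | hn
  · refine ⟨1, one_pos, fun K hK E _ b => ?_⟩
    have := NormalCurves.subsingleton_PSpace_zero
    let q : NormalCurves.PSpace 0 := Projectivization.mk ℂ (EuclideanSpace.single 0 1) (by simp)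
    exact ⟨fun _ => q, NormalCurves.const_mem_normalClass q (by positivity),
      fun m => Subsingleton.elim _ _⟩
  obtain ⟨ρ, B, hρ, hB, h⟩ := NormalCurves.exists_curve_of_separated hn
  refine ⟨ρ * B, by positivity, fun K hK E hE b => ?_⟩
  have hc : ‖((ρ / K : ℝ) : ℂ)‖ = ρ / K := by
    rw [Complex.norm_real, Real.norm_of_nonneg (by positivity)]
  obtain ⟨g, hg, hgb⟩ := h E (fun m => ((ρ / K : ℝ) : ℂ) * m) b fun m m' hne => by
    have h1 : K ≤ dist (m : ℂ) m' := hE m.2 m'.2 fun he => hne (Subtype.ext he)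
    beta_reduce
    rw [dist_eq_norm, ← mul_sub, norm_mul, hc, ← dist_eq_norm]
    calc ρ = ρ / K * K := by field_simp
      _ ≤ _ := by gcongr
  refine ⟨fun z => g (((ρ / K : ℝ) : ℂ) * z), NormalCurves.mem_normalClass fun z => ?_, hgb⟩
  obtain ⟨F, hF, hFB⟩ := hg (((ρ / K : ℝ) : ℂ) * z)
  refine ⟨_, hF.comp_mul_left, ?_⟩
  rw [NormalCurves.repSphericalDeriv_comp_mul_left, hc]
  calc ρ / K * _ ≤ ρ / K * B := by gcongr
    _ = ρ * B / K := by ring
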